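/- Let $G=\mathrm{SU}(3)$ and let $K=\mathrm S(\mathrm U(2)\times\mathrm U(1))\subset G$ be the subgroup of all matrices $k=\begin{pmatrix}A&0\\0&(\det A)^{-1}\end{pmatrix}$ with $A\in\mathrm U(2)$; let $dk$ be the Haar measure on $K$ with $\int_K dk=1$. For $n\in\mathbb Z$ and $\ell\in\mathbb Z_{\ge 0}$ let $\pi_{n,\ell}(A)=(\det A)^n A^\ell$, where $A^\ell$ denotes the $\ell$-th symmetric power of $A$, acting on the $\ell$-th symmetric power $V$ of $\mathbb C^2$; for $n\ge 0$ this formula defines a multiplicative polynomial map on all $2\times 2$ complex matrices. Via $k\mapsto A$, regard $\pi=\pi_{n,\ell}$ as a representation of $K$ on $V$, and put $\chi_\pi(k)=\dim(V)\,\operatorname{tr}\pi(k)$. For $g\in G$ let $A(g)$ be the upper-left $2\times2$ block of $g$. **Theorem.** Let $n\ge 0$ and $\ell\ge 0$ be integers and $\pi=\pi_{n,\ell}$. Then the function $\Phi_\pi:G\to\operatorname{End}(V)$, $\Phi_\pi(g)=\pi_{n,\ell}(A(g))$, is an irreducible spherical function on $G$ of type $\pi$. That is: $\pi$ is a continuous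 irreducible representation of $K$; $\Phi_\pi$ is continuous; $\Phi_\pi(e)=I$; $$\Phi_\pi(x)\Phi_\pi(y)=\int_K\chi_\pi(k^{-1})\,\Phi_\pi(xky)\,dk\qquad\text{for all }x,y\in G;$$ and $V\neq 0$ has no subspaces invariant under all $\Phi_\pi(g)$, $g\in G$, other than $0$ and $V$. -/

import Mathlib

open MeasureTheory

section Spherical

variable {G : Type*} [Group G] {V W : Type*} [AddCommGroup V] [Module ℂ V]
  [AddCommGroup W] [Module ℂ W]

/-- The Haar measure `dk` on a compact group, normalized by `∫ dk = 1`. -/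
noncomputable def normalizedHaar (K : Type*) [Group K] [TopologicalSpace K]
    [IsTopologicalGroup K] [CompactSpace K] [MeasurableSpace K] [BorelSpace K] : Measure K :=
  Measure.haarMeasure ⊤

/-- Continuity of a map into the endomorphisms of a finite dimensional complex vector space, for
the unique Hausdorff linear topology of `End V`: all scalar components are continuous. -/
def ContinuousEnd {X : Type*} [TopologicalSpace X] (F : X → Module.End ℂ V) : Prop :=
  ∀ L : Module.Dual ℂ (Module.End ℂ V), Continuous fun x => L (F x)

/-- `T` is the integral of the `End V`-valued function `F` (with `V` finite dimensional): every
scalar component of `F` is integrable, with integral the corresponding component of `T`. -/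
def HasEndIntegral {X : Type*} [MeasurableSpace X] (μ : Measure X) (F : X → Module.End ℂ V)
    (T : Module.End ℂ V) : Prop :=
  ∀ L : Module.Dual ℂ (Module.End ℂ V),
    Integrable (fun x => L (F x)) μ ∧ ∫ x, L (F x) ∂μ = L T

/-- The function `χ_δ = d(δ) ξ_δ`: the degree times the character of the representation `δ`. -/
noncomputable def degChar {K : Type*} [Group K] (δ : Representation ℂ K W) (k : K) : ℂ :=
  (Module.finrank ℂ W : ℂ) * LinearMap.trace ℂ W (δ k)

/-- `Φ : G → End V` is a spherical function on `G`, relative to the compact subgroup `K`, of type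
the class of the continuous finite dimensional irreducible representation `δ` of `K`:
`Φ` is continuous, `Φ(e) = I`, and `Φ(x) Φ(y) = ∫_K χ_δ(k⁻¹) Φ(x k y) dk` for all `x`, `y`. -/
structure IsSphericalFunction [TopologicalSpace G] [IsTopologicalGroup G] [MeasurableSpace G]
    [BorelSpace G] (K : Subgroup G) [CompactSpace K] [FiniteDimensional ℂ V]
    [FiniteDimensional ℂ W] (δ : Representation ℂ K W) (Φ : G → Module.End ℂ V) : Prop where
  type_irreducible : δ.IsIrreducible
  type_continuous : ContinuousEnd fun k : K => δ k
  continuous : ContinuousEnd Φ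
  map_one : Φ 1 = 1
  integral_eq : ∀ x y : G,
    HasEndIntegral (normalizedHaar K) (fun k : K => degChar δ k⁻¹ • Φ (x * k * y)) (Φ x * Φ y)

/-- The operators `Φ(g)` form an irreducible family on `V`: `V ≠ 0`, and the only subspaces
invariant under all of them are `0` and `V`. -/
def IsIrreducibleFamily {X : Type*} (Φ : X → Module.End ℂ V) : Prop :=
  Nontrivial V ∧
    ∀ U : Submodule ℂ V, (∀ g, ∀ v ∈ U, Φ g v ∈ U) → U = ⊥ ∨ U = ⊤

end Spherical

section SymmetricPower

/-- The `ℓ`-th symmetric power of `ℂ²`: the degree `ℓ` part of the symmetric algebra of `ℂ²`,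
which is the polynomial algebra on the standard basis vectors `X 0`, `X 1`. -/
abbrev SymC2 (ℓ : ℕ) : Type := MvPolynomial.homogeneousSubmodule (Fin 2) ℂ ℓ

instance (ℓ : ℕ) : FiniteDimensional ℂ (SymC2 ℓ) :=
  Module.Finite.iff_fg.mpr (MvPolynomial.homogeneousSubmodule_fg (Fin 2) ℂ ℓ)

/-- The algebra endomorphism of the symmetric algebra of `ℂ²` induced by a `2 × 2` matrix `A`: it
sends the basis vector `X j` to `∑ i, A i j X i`, the `j`-th column of `A`. -/
noncomputable def symAlgMap (A : Matrix (Fin 2) (Fin 2) ℂ) :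
    MvPolynomial (Fin 2) ℂ →ₐ[ℂ] MvPolynomial (Fin 2) ℂ :=
  MvPolynomial.aeval fun j => ∑ i, A i j • MvPolynomial.X i

theorem symAlgMap_X (A : Matrix (Fin 2) (Fin 2) ℂ) (j : Fin 2) :
    symAlgMap A (MvPolynomial.X j) = ∑ i, A i j • MvPolynomial.X i := by
  simp [symAlgMap]

theorem symAlgMap_one : symAlgMap 1 = AlgHom.id ℂ _ := by
  ext1 j
  rw [symAlgMap_X]
  simp [Matrix.one_apply]

theorem symAlgMap_mul (A B : Matrix (Fin 2) (Fin 2) ℂ) :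
    symAlgMap (A * B) = (symAlgMap A).comp (symAlgMap B) := by
  ext1 j
  rw [AlgHom.comp_apply, symAlgMap_X, symAlgMap_X]
  simp only [map_add, map_smul, symAlgMap_X, Matrix.mul_apply, Fin.sum_univ_two]
  module

theorem symAlgMap_mem (A : Matrix (Fin 2) (Fin 2) ℂ) (ℓ : ℕ) :
    ∀ p ∈ MvPolynomial.homogeneousSubmodule (Fin 2) ℂ ℓ,
      (symAlgMap A).toLinearMap p ∈ MvPolynomial.homogeneousSubmodule (Fin 2) ℂ ℓ := by
  intro p hp
  rw [MvPolynomial.mem_homogeneousSubmodule] at hp ⊢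
  have h := hp.aeval (n := 1) (fun j => ∑ i, A i j • (MvPolynomial.X i : MvPolynomial (Fin 2) ℂ))
    (fun j => MvPolynomial.IsHomogeneous.sum _ _ _ fun i _ =>
      (MvPolynomial.homogeneousSubmodule (Fin 2) ℂ 1).smul_mem _
        (MvPolynomial.isHomogeneous_X ℂ i))
  simpa [symAlgMap] using h

/-- The symmetric power `A ↦ A^ℓ`, a multiplicative map on all `2 × 2` matrices. -/
noncomputable def symPow (ℓ : ℕ) : Matrix (Fin 2) (Fin 2) ℂ →* Module.End ℂ (SymC2 ℓ) where
  toFun A := (symAlgMap A).toLinearMap.restrict (symAlgMap_mem A ℓ)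
  map_one' := by
    ext1 p
    apply Subtype.ext
    simp [LinearMap.restrict_apply, symAlgMap_one]
  map_mul' A B := by
    ext1 p
    apply Subtype.ext
    simp [LinearMap.restrict_apply, symAlgMap_mul]

/-- `π_{n,ℓ}(A) = (det A)^n A^ℓ`. For every integer `n` this is the usual formula on invertible
matrices; for `n ≥ 0` it is polynomial in the entries, hence the holomorphic multiplicative
extension to all `2 × 2` matrices. -/
noncomputable def piRep (n : ℤ) (ℓ : ℕ) :
    Matrix (Fin 2) (Fin 2) ℂ →* Module.End ℂ (SymC2 ℓ) where
  toFun A := A.det ^ n • symPow ℓ A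
  map_one' := by simp
  map_mul' A B := by
    rw [Matrix.det_mul, mul_zpow, map_mul, smul_mul_smul_comm]

end SymmetricPower

section SU3

/-- The group `SU(3)`. -/
noncomputable abbrev SU3 : Type := Matrix.specialUnitaryGroup (Fin 3) ℂ

instance : IsTopologicalGroup SU3 where
  continuous_mul := continuous_mul
  continuous_inv := by
    refine Continuous.subtype_mk (f := fun g : SU3 => star (g : Matrix (Fin 3) (Fin 3) ℂ)) ?_ _
    exact continuous_star.comp continuous_subtype_val

noncomputable instance : MeasurableSpace SU3 := borel SU3

instance : BorelSpace SU3 := ⟨rfl⟩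

/-- The upper left `2 × 2` block `A(g)` of a `3 × 3` matrix. -/
noncomputable def upperLeft (g : Matrix (Fin 3) (Fin 3) ℂ) : Matrix (Fin 2) (Fin 2) ℂ :=
  !![g 0 0, g 0 1; g 1 0, g 1 1]

/-- The matrix with diagonal blocks `A` and `(det A)⁻¹`. -/
noncomputable def blockDiag (A : Matrix (Fin 2) (Fin 2) ℂ) : Matrix (Fin 3) (Fin 3) ℂ :=
  !![A 0 0, A 0 1, 0; A 1 0, A 1 1, 0; 0, 0, A.det⁻¹]

theorem upperLeft_blockDiag (A : Matrix (Fin 2) (Fin 2) ℂ) : upperLeft (blockDiag A) = A := by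
  ext i j
  fin_cases i <;> fin_cases j <;> simp [upperLeft, blockDiag]

theorem blockDiag_mul (A B : Matrix (Fin 2) (Fin 2) ℂ) :
    blockDiag (A * B) = blockDiag A * blockDiag B := by
  ext i j
  fin_cases i <;> fin_cases j <;>
    simp [blockDiag, Matrix.mul_apply, Fin.sum_univ_succ, mul_comm B.det⁻¹]

theorem blockDiag_star (A : Matrix (Fin 2) (Fin 2) ℂ) :
    blockDiag (star A) = star (blockDiag A) := by
  have h : (star A).det⁻¹ = star (A.det⁻¹) := by
    rw [Matrix.star_eq_conjTranspose, Matrix.det_conjTranspose, star_inv₀]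
  ext i j
  fin_cases i <;> fin_cases j <;>
    simp [blockDiag, Matrix.star_apply, h]

/-- The subgroup `K = S(U(2) × U(1))` of `SU(3)`: the matrices with diagonal blocks `A` and
`(det A)⁻¹`, where `A ∈ U(2)`. -/
noncomputable def subgroupK : Subgroup SU3 where
  carrier := {g | ∃ A ∈ Matrix.unitaryGroup (Fin 2) ℂ,
    (g : Matrix (Fin 3) (Fin 3) ℂ) = blockDiag A}
  one_mem' := ⟨1, one_mem _, by
    ext i j
    fin_cases i <;> fin_cases j <;> simp [blockDiag]⟩
  mul_mem' := by
    rintro g h ⟨A, hA, hg⟩ ⟨B, hB, hh⟩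
    refine ⟨A * B, mul_mem hA hB, ?_⟩
    rw [blockDiag_mul, ← hg, ← hh]
    rfl
  inv_mem' := by
    rintro g ⟨A, hA, hg⟩
    refine ⟨star A, Unitary.star_mem hA, ?_⟩
    rw [blockDiag_star, ← hg]
    rfl

theorem isCompact_unitaryGroup (n : ℕ) :
    IsCompact (Matrix.unitaryGroup (Fin n) ℂ : Set (Matrix (Fin n) (Fin n) ℂ)) := by
  have hc : IsCompact (Set.univ.pi fun _ : Fin n => Set.univ.pi fun _ : Fin n =>
      Metric.closedBall (0 : ℂ) 1) :=
    isCompact_univ_pi fun _ => isCompact_univ_pi fun _ => isCompact_closedBall 0 1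
  refine IsCompact.of_isClosed_subset hc ?_ ?_
  · have h : (Matrix.unitaryGroup (Fin n) ℂ : Set (Matrix (Fin n) (Fin n) ℂ)) =
        {A | A * star A = 1} := by
      ext A
      exact Matrix.mem_unitaryGroup_iff
    rw [h]
    exact isClosed_eq (continuous_id.mul continuous_star) continuous_const
  · intro A hA i _ j _
    rw [mem_closedBall_zero_iff]
    exact entry_norm_bound_of_unitary hA i j

instance : CompactSpace SU3 := by
  refine isCompact_iff_compactSpace.mp ?_
  have h : (Matrix.specialUnitaryGroup (Fin 3) ℂ : Set (Matrix (Fin 3) (Fin 3) ℂ)) =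
      (Matrix.unitaryGroup (Fin 3) ℂ : Set (Matrix (Fin 3) (Fin 3) ℂ)) ∩ {A | A.det = 1} := by
    ext A
    exact Matrix.mem_specialUnitaryGroup_iff
  rw [h]
  exact (isCompact_unitaryGroup 3).inter_right
    (isClosed_eq (continuous_id.matrix_det) continuous_const)

theorem continuous_upperLeft : Continuous upperLeft := by
  refine continuous_matrix fun i j => ?_
  fin_cases i <;> fin_cases j <;> exact continuous_id.matrix_elem _ _

theorem mem_subgroupK_iff (g : SU3) : g ∈ subgroupK ↔
    upperLeft g ∈ Matrix.unitaryGroup (Fin 2) ℂ ∧ (g.1 0 2 = 0 ∧ g.1 1 2 = 0) ∧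
      (g.1 2 0 = 0 ∧ g.1 2 1 = 0) ∧ g.1 2 2 * (upperLeft g).det = 1 := by
  constructor
  · rintro ⟨A, hA, hg⟩
    have hd : A.det ≠ 0 := by
      intro h0
      have h1 := congrArg Matrix.det (Matrix.mem_unitaryGroup_iff.mp hA)
      simp [h0] at h1
    rw [hg, upperLeft_blockDiag]
    refine ⟨hA, ⟨rfl, rfl⟩, ⟨rfl, rfl⟩, ?_⟩
    exact inv_mul_cancel₀ hd
  · rintro ⟨hA, ⟨h1, h2⟩, ⟨h3, h4⟩, h5⟩
    refine ⟨_, hA, ?_⟩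
    have h6 := eq_inv_of_mul_eq_one_left h5
    ext i j
    fin_cases i <;> fin_cases j
    all_goals first | exact h1 | exact h2 | exact h3 | exact h4 | exact h6 | rfl

instance : CompactSpace subgroupK := by
  refine isCompact_iff_compactSpace.mp (IsClosed.isCompact ?_)
  have hu : Continuous fun g : SU3 => upperLeft (g : Matrix (Fin 3) (Fin 3) ℂ) :=
    continuous_upperLeft.comp continuous_subtype_val
  have he : ∀ i j : Fin 3, Continuous fun g : SU3 => g.1 i j := fun i j =>
    (continuous_apply_apply i j).comp continuous_subtype_val
  have hz : ∀ i j : Fin 3, IsClosed {g : SU3 | g.1 i j = 0} := fun i j =>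
    isClosed_eq (he i j) continuous_const
  have h : (subgroupK : Set SU3) =
      {g : SU3 | upperLeft g ∈ (Matrix.unitaryGroup (Fin 2) ℂ : Set (Matrix _ _ ℂ))} ∩
        (({g : SU3 | g.1 0 2 = 0} ∩ {g : SU3 | g.1 1 2 = 0}) ∩
        (({g : SU3 | g.1 2 0 = 0} ∩ {g : SU3 | g.1 2 1 = 0}) ∩
        {g : SU3 | g.1 2 2 * (upperLeft g).det = 1})) := by
    ext g
    exact mem_subgroupK_iff g
  rw [h]
  exact ((isCompact_unitaryGroup 2).isClosed.preimage hu).inter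
    (((hz 0 2).inter (hz 1 2)).inter (((hz 2 0).inter (hz 2 1)).inter
      (isClosed_eq ((he 2 2).mul hu.matrix_det) continuous_const)))

/-- The isomorphism `k ↦ A` of `K` onto `U(2)`, as a multiplicative map into `2 × 2` matrices. -/
noncomputable def blockHom : subgroupK →* Matrix (Fin 2) (Fin 2) ℂ where
  toFun k := upperLeft ((k : SU3) : Matrix (Fin 3) (Fin 3) ℂ)
  map_one' := by
    ext i j
    fin_cases i <;> fin_cases j <;> simp [upperLeft]
  map_mul' := by
    rintro ⟨g, A, hA, hg⟩ ⟨h, B, hB, hh⟩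
    have e : ((g * h : SU3) : Matrix (Fin 3) (Fin 3) ℂ) = blockDiag (A * B) := by
      rw [blockDiag_mul, ← hg, ← hh]
      rfl
    change upperLeft ((g * h : SU3) : Matrix (Fin 3) (Fin 3) ℂ) = upperLeft _ * upperLeft _
    rw [e, hg, hh, upperLeft_blockDiag, upperLeft_blockDiag, upperLeft_blockDiag]

/-- The representation `π_{n,ℓ}` of `K`. -/
noncomputable def piK (n : ℤ) (ℓ : ℕ) : Representation ℂ subgroupK (SymC2 ℓ) :=
  (piRep n ℓ).comp blockHom

/-- `Φ_π(g) = π_{n,ℓ}(A(g))`. -/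
noncomputable def PhiPi (n : ℤ) (ℓ : ℕ) (g : SU3) : Module.End ℂ (SymC2 ℓ) :=
  piRep n ℓ (upperLeft (g : Matrix (Fin 3) (Fin 3) ℂ))

end SU3

/-!
Write `A, A'` for the upper left blocks of `x, y ∈ SU(3)`, `b` for the upper part of the last column
of `x`, `c'` for the left part of the last row of `y`, and `U` for the block of `k ∈ K`. The upper
left block of `x k y` is `A U A' + (det U)⁻¹ b c'`. If the second summand were absent, then
`Φ(x k y) = π(A) π(U) π(A')` by multiplicativity, and the functional equation would reduce to the
relation `∫ χ_π(k⁻¹) π(k) dk = 1` (`hasEndIntegral_degChar_smul`), which holds on every compact group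
by averaging conjugates and Schur's lemma.

The second summand does not contribute. Translation of the integration variable by the central
element of `K` with block `ζ • 1` turns the argument of `π` into
`ζ • (A U A' + ζ⁻³ (det U)⁻¹ b c')`; the factor `ζ` acts by `ζ ^ (2 n + ℓ)`, which cancels against
the central character of `χ_π(k⁻¹)`. Hence the integral does not change when the second summand is
multiplied by any `w` of modulus one (`integral_eq_integral_rotate`). As `n ≥ 0`, the integrand is a
polynomial in `w` of degree bounded independently of `k` (`piRep_coeff_mem_matrixPolyFun`,
`exists_polynomial_on_lines`), so that averaging over the roots of unity of large order leaves its
value at `w = 0` (`integral_PhiPi_eq`).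

Irreducibility, both of `π` and of the family `Φ_π(g)`, is that of the forms of degree `ℓ` under
`U(2)` (`monomial_mem_of_invariant`): every block in `U(2)` is the block of an element of `K`.
-/

/-! ### Operator-valued functions through their matrix coefficients -/

section EndValued

variable {V W : Type*} [AddCommGroup V] [Module ℂ V] [AddCommGroup W] [Module ℂ W]

/-- Every functional on `End V` is a combination of matrix coefficients, so that continuity and
integrals of `End V`-valued functions can be tested on those. -/
theorem dual_end_eq_sum {ι : Type*} [Fintype ι] (b : Module.Basis ι ℂ V)
    (L : Module.Dual ℂ (Module.End ℂ V)) (T : Module.End ℂ V) :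
    L T = ∑ i, ∑ j, L ((b.coord j).smulRight (b i)) * b.coord i (T (b j)) := by
  classical
  have h : T = ∑ i, ∑ j, b.coord i (T (b j)) • (b.coord j).smulRight (b i) := by
    refine b.ext fun k => ?_
    simp only [LinearMap.sum_apply, LinearMap.smul_apply, LinearMap.smulRight_apply,
      Module.Basis.coord_apply, Module.Basis.repr_self, Finsupp.single_apply, ite_smul, one_smul,
      zero_smul, smul_ite, smul_zero, Finset.sum_ite_eq, Finset.mem_univ, if_true]
    exact (b.sum_repr _).symm
  conv_lhs => rw [h]
  simp only [map_sum, map_smul, smul_eq_mul, mul_comm]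

section Topology

variable {X Y : Type*} [TopologicalSpace X] [TopologicalSpace Y]

theorem ContinuousEnd.of_apply [FiniteDimensional ℂ V] {F : X → Module.End ℂ V}
    (h : ∀ (φ : Module.Dual ℂ V) (v : V), Continuous fun x => φ (F x v)) : ContinuousEnd F := by
  intro L
  rw [funext fun x => dual_end_eq_sum (Module.finBasis ℂ V) L (F x)]
  exact continuous_finsetSum _ fun i _ => continuous_finsetSum _ fun j _ =>
    continuous_const.mul (h _ _)

theorem ContinuousEnd.apply {F : X → Module.End ℂ V} (h : ContinuousEnd F)
    (φ : Module.Dual ℂ V) (v : V) : Continuous fun x => φ (F x v) :=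
  h (φ ∘ₗ LinearMap.applyₗ v)

theorem ContinuousEnd.comp {F : X → Module.End ℂ V} (h : ContinuousEnd F) {f : Y → X}
    (hf : Continuous f) : ContinuousEnd fun y => F (f y) :=
  fun L => (h L).comp hf

theorem ContinuousEnd.const (T : Module.End ℂ V) : ContinuousEnd fun _ : X => T :=
  fun _ => continuous_const

theorem ContinuousEnd.mul [FiniteDimensional ℂ V] {F H : X → Module.End ℂ V}
    (hF : ContinuousEnd F) (hH : ContinuousEnd H) : ContinuousEnd fun x => F x * H x := by
  refine ContinuousEnd.of_apply fun φ v => ?_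
  let b := Module.finBasis ℂ V
  have h : ∀ x, φ ((F x * H x) v) = ∑ i, b.coord i (H x v) * φ (F x (b i)) := by
    intro x
    conv_lhs => rw [Module.End.mul_apply, ← b.sum_repr (H x v)]
    simp only [map_sum, map_smul, smul_eq_mul, Module.Basis.coord_apply]
  simp_rw [h]
  exact continuous_finsetSum _ fun i _ => (hH.apply _ _).mul (hF.apply _ _)

end Topology

section Integral

variable {X : Type*} [MeasurableSpace X] {μ : Measure X}

theorem HasEndIntegral.of_apply [FiniteDimensional ℂ V] {F : X → Module.End ℂ V}
    {T : Module.End ℂ V}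
    (h : ∀ (φ : Module.Dual ℂ V) (v : V),
      Integrable (fun x => φ (F x v)) μ ∧ ∫ x, φ (F x v) ∂μ = φ (T v)) :
    HasEndIntegral μ F T := by
  intro L
  have hi := fun i j => ((h ((Module.finBasis ℂ V).coord i) (Module.finBasis ℂ V j)).1.const_mul
    (L (((Module.finBasis ℂ V).coord j).smulRight (Module.finBasis ℂ V i))))
  rw [funext fun x => dual_end_eq_sum (Module.finBasis ℂ V) L (F x),
    dual_end_eq_sum (Module.finBasis ℂ V) L T]
  refine ⟨integrable_finsetSum _ fun i _ => integrable_finsetSum _ fun j _ => hi i j, ?_⟩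
  rw [integral_finsetSum _ fun i _ => integrable_finsetSum _ fun j _ => hi i j]
  refine Finset.sum_congr rfl fun i _ => ?_
  rw [integral_finsetSum _ fun j _ => hi i j]
  refine Finset.sum_congr rfl fun j _ => ?_
  rw [integral_const_mul, (h _ _).2]

theorem HasEndIntegral.apply {F : X → Module.End ℂ V} {T : Module.End ℂ V}
    (h : HasEndIntegral μ F T) (φ : Module.Dual ℂ V) (v : V) :
    Integrable (fun x => φ (F x v)) μ ∧ ∫ x, φ (F x v) ∂μ = φ (T v) :=
  h (φ ∘ₗ LinearMap.applyₗ v)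

theorem HasEndIntegral.map {F : X → Module.End ℂ V} {T : Module.End ℂ V}
    (h : HasEndIntegral μ F T) (f : Module.End ℂ V →ₗ[ℂ] Module.End ℂ W) :
    HasEndIntegral μ (fun x => f (F x)) (f T) :=
  fun L => h (L ∘ₗ f)

theorem HasEndIntegral.unique [FiniteDimensional ℂ V] {F : X → Module.End ℂ V}
    {S T : Module.End ℂ V} (hS : HasEndIntegral μ F S) (hT : HasEndIntegral μ F T) : S = T := by
  rw [← sub_eq_zero, ← Module.forall_dual_apply_eq_zero_iff ℂ]
  intro L
  rw [map_sub, ← (hS L).2, ← (hT L).2, sub_self]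

theorem ContinuousEnd.integrable [TopologicalSpace X] [CompactSpace X] [BorelSpace X]
    [IsFiniteMeasureOnCompacts μ] {F : X → Module.End ℂ V} (hF : ContinuousEnd F)
    (L : Module.Dual ℂ (Module.End ℂ V)) : Integrable (fun x => L (F x)) μ :=
  (hF L).integrable_of_hasCompactSupport (HasCompactSupport.of_compactSpace _)

theorem ContinuousEnd.exists_hasEndIntegral [FiniteDimensional ℂ V] [TopologicalSpace X]
    [CompactSpace X] [BorelSpace X] [IsFiniteMeasureOnCompacts μ] {F : X → Module.End ℂ V}
    (hF : ContinuousEnd F) : ∃ T, HasEndIntegral μ F T := by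
  -- The functional `L ↦ ∫ L (F x)` on the dual is evaluation at a vector, by reflexivity.
  let I : Module.Dual ℂ (Module.Dual ℂ (Module.End ℂ V)) :=
    { toFun := fun L => ∫ x, L (F x) ∂μ
      map_add' := fun L M => integral_add (hF.integrable L) (hF.integrable M)
      map_smul' := fun c L => integral_const_mul c _ }
  obtain ⟨T, hT⟩ := (Module.bijective_dual_eval ℂ (Module.End ℂ V)).2 I
  exact ⟨T, fun L => ⟨hF.integrable L, (LinearMap.congr_fun hT L).symm⟩⟩

end Integral

end EndValued

/-! ### Schur orthogonality on a compact group -/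

section Schur

variable {K : Type*} [Group K] {V : Type*} [AddCommGroup V] [Module ℂ V]

theorem Representation.IsIrreducible.eq_bot_or_eq_top_of_invariant {δ : Representation ℂ K V}
    (hδ : δ.IsIrreducible) (U : Submodule ℂ V) (hU : ∀ k, ∀ v ∈ U, δ k v ∈ U) :
    U = ⊥ ∨ U = ⊤ := by
  rcases IsSimpleOrder.eq_bot_or_eq_top
      (⟨U, fun k v hv => hU k v hv⟩ : Subrepresentation δ) with h | h
  · exact Or.inl (congrArg Subrepresentation.toSubmodule h)
  · exact Or.inr (congrArg Subrepresentation.toSubmodule h)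

theorem Representation.IsIrreducible.nontrivial {δ : Representation ℂ K V}
    (hδ : δ.IsIrreducible) : Nontrivial V := by
  by_contra h
  rw [not_nontrivial_iff_subsingleton] at h
  obtain ⟨A, B, hAB⟩ := hδ.toNontrivial.exists_pair_ne
  exact hAB (Subrepresentation.toSubmodule_injective (Subsingleton.elim _ _))

theorem Representation.isIrreducible_of_isIrreducibleFamily {δ : Representation ℂ K V}
    (h : IsIrreducibleFamily fun k => δ k) : δ.IsIrreducible := by
  obtain ⟨hV, hU⟩ := h
  have : Nontrivial (Subrepresentation δ) :=
    ⟨⊥, ⊤, fun e => bot_ne_top (α := Submodule ℂ V) (congrArg Subrepresentation.toSubmodule e)⟩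
  refine { eq_bot_or_eq_top := fun A => ?_ }
  exact (hU A.toSubmodule fun k v hv => A.apply_mem_toSubmodule k hv).imp
    (fun e => Subrepresentation.toSubmodule_injective e)
    (fun e => Subrepresentation.toSubmodule_injective e)

/-- Schur's lemma. -/
theorem Representation.IsIrreducible.exists_eq_smul_one [FiniteDimensional ℂ V]
    {δ : Representation ℂ K V} (hδ : δ.IsIrreducible) (T : Module.End ℂ V)
    (hT : ∀ k, δ k * T = T * δ k) : ∃ c : ℂ, T = c • (1 : Module.End ℂ V) := by
  have := hδ.nontrivial
  obtain ⟨c, hc⟩ := Module.End.exists_eigenvalue T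
  refine ⟨c, ?_⟩
  have h := (hδ.eq_bot_or_eq_top_of_invariant (T.eigenspace c) fun k v hv => ?_).resolve_left hc
  · refine LinearMap.ext fun v => ?_
    have hv : v ∈ T.eigenspace c := h ▸ Submodule.mem_top
    simpa using Module.End.mem_eigenspace_iff.mp hv
  · rw [Module.End.mem_eigenspace_iff] at hv ⊢
    rw [← Module.End.mul_apply, ← hT, Module.End.mul_apply, hv, map_smul]

variable [TopologicalSpace K] [IsTopologicalGroup K] [CompactSpace K] [MeasurableSpace K]
  [BorelSpace K]

instance : (normalizedHaar K).IsHaarMeasure := by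
  unfold normalizedHaar; infer_instance

instance : IsProbabilityMeasure (normalizedHaar K) :=
  ⟨Measure.haarMeasure_self (K₀ := ⊤)⟩

/-- The average of `T` over the conjugation action of `K` is the scalar `tr T / dim V`. -/
theorem hasEndIntegral_conj [FiniteDimensional ℂ V] {δ : Representation ℂ K V}
    (hδ : δ.IsIrreducible) (hc : ContinuousEnd fun k => δ k) (T : Module.End ℂ V) :
    HasEndIntegral (normalizedHaar K) (fun k => δ k * T * δ k⁻¹)
      ((LinearMap.trace ℂ V T / Module.finrank ℂ V) • (1 : Module.End ℂ V)) := by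
  have := hδ.nontrivial
  obtain ⟨S, hS⟩ := ((hc.mul (ContinuousEnd.const T)).mul
    (hc.comp continuous_inv)).exists_hasEndIntegral (μ := normalizedHaar K)
  have hcomm : ∀ h, δ h * S = S * δ h := by
    intro h
    have h1 := hS.map (LinearMap.mulLeft ℂ (δ h) ∘ₗ LinearMap.mulRight ℂ (δ h⁻¹))
    have h2 : HasEndIntegral (normalizedHaar K)
        (fun k => δ (h * k) * T * δ (h * k)⁻¹) S := fun L =>
      ⟨((hS L).1.comp_mul_left h), by
        rw [← (hS L).2]
        exact integral_mul_left_eq_self (μ := normalizedHaar K)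
          (fun k => L (δ k * T * δ k⁻¹)) h⟩
    have h3 : δ h * (S * δ h⁻¹) = S := by
      refine h1.unique ?_
      convert h2 using 2 with k
      simp [mul_assoc]
    calc δ h * S = δ h * (S * δ h⁻¹) * δ h := by
          rw [mul_assoc, mul_assoc, ← map_mul, inv_mul_cancel, map_one, mul_one]
      _ = S * δ h := by rw [h3]
  obtain ⟨c, rfl⟩ := hδ.exists_eq_smul_one S hcomm
  -- The scalar is found by taking traces, which conjugation does not change.
  have htr := (hS (LinearMap.trace ℂ V)).2
  have hk : ∀ k, LinearMap.trace ℂ V (δ k * T * δ k⁻¹) = LinearMap.trace ℂ V T := by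
    intro k
    rw [LinearMap.trace_mul_comm, ← mul_assoc, ← map_mul, inv_mul_cancel, map_one, one_mul]
  simp only [hk, integral_const, probReal_univ, one_smul, map_smul, LinearMap.trace_one,
    smul_eq_mul] at htr
  have hd : (Module.finrank ℂ V : ℂ) ≠ 0 := Nat.cast_ne_zero.mpr Module.finrank_pos.ne'
  rwa [htr, mul_div_cancel_right₀ _ hd]

/-- The operator form of the orthogonality relations: `∫ χ_δ(k⁻¹) δ(k) dk = 1`. -/
theorem hasEndIntegral_degChar_smul [FiniteDimensional ℂ V] {δ : Representation ℂ K V}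
    (hδ : δ.IsIrreducible) (hc : ContinuousEnd fun k => δ k) :
    HasEndIntegral (normalizedHaar K) (fun k => degChar δ k⁻¹ • δ k) 1 := by
  have := hδ.nontrivial
  refine HasEndIntegral.of_apply fun φ v => ?_
  let b := Module.finBasis ℂ V
  -- `tr δ(k⁻¹) • δ(k) v = ∑ j, δ(k) E_j δ(k⁻¹) b_j`, where `E_j w = (b_j-coordinate of w) • v`.
  have hb : ∀ k, φ ((degChar δ k⁻¹ • δ k) v) = ∑ j, Module.finrank ℂ V *
      φ ((δ k * (b.coord j).smulRight v * δ k⁻¹) (b j)) := by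
    intro k
    rw [degChar, LinearMap.trace_eq_matrix_trace ℂ b, Matrix.trace, Finset.mul_sum]
    simp [LinearMap.toMatrix_apply, Finset.sum_mul, mul_assoc]
  have hi := fun j => (hasEndIntegral_conj hδ hc ((b.coord j).smulRight v)).apply φ (b j)
  simp_rw [hb]
  refine ⟨integrable_finsetSum _ fun j _ => (hi j).1.const_mul _, ?_⟩
  rw [integral_finsetSum _ fun j _ => (hi j).1.const_mul _]
  have hd : (Module.finrank ℂ V : ℂ) ≠ 0 := Nat.cast_ne_zero.mpr Module.finrank_pos.ne'
  have ht : ∀ j, LinearMap.trace ℂ V ((b.coord j).smulRight v) = b.repr v j := by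
    intro j
    simp
  conv_rhs => rw [Module.End.one_apply, ← b.sum_repr v, map_sum]
  refine Finset.sum_congr rfl fun j _ => ?_
  rw [integral_const_mul, (hi j).2, ht, LinearMap.smul_apply, Module.End.one_apply, map_smul,
    map_smul, smul_eq_mul, smul_eq_mul, ← mul_assoc, mul_div_cancel₀ _ hd]

end Schur

/-! ### Filtering by roots of unity -/

/-- Finite Fourier inversion: averaging over the powers of a primitive `N`-th root of unity
extracts a coefficient of a polynomial of degree `< N`. The exponent `N - a` stands for `-a`. -/
theorem sum_isPrimitiveRoot_smul {M : Type*} [AddCommGroup M] [Module ℂ M] {N : ℕ} {ω : ℂ}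
    (hω : IsPrimitiveRoot ω N) (v : ℕ → M) {a : ℕ} (ha : a < N) :
    ∑ j ∈ Finset.range N, (ω ^ j) ^ (N - a) • ∑ i ∈ Finset.range N, (ω ^ j) ^ i • v i =
      (N : ℂ) • v a := by
  simp_rw [Finset.smul_sum, smul_smul, ← pow_add]
  rw [Finset.sum_comm]
  simp_rw [← Finset.sum_smul]
  rw [Finset.sum_eq_single_of_mem a (Finset.mem_range.mpr ha)]
  · congr 1
    rw [Nat.sub_add_cancel ha.le]
    simp_rw [← pow_mul, mul_comm _ N, pow_mul, hω.pow_eq_one, one_pow]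
    simp
  · intro i hi hia
    rw [Finset.mem_range] at hi
    have h1 : ω ^ (N - a + i) ≠ 1 := by
      rw [Ne, hω.pow_eq_one_iff_dvd]
      rintro ⟨c, hc⟩
      have hc1 : c = 1 := by
        have h0 : 0 < N * c := by omega
        have h2 : N * c < N * 2 := by omega
        have := Nat.pos_of_mul_pos_left h0
        have := Nat.lt_of_mul_lt_mul_left h2
        omega
      subst hc1
      omega
    have h2 := mul_neg_geom_sum (ω ^ (N - a + i)) N
    rw [← pow_mul, mul_comm _ N, pow_mul, hω.pow_eq_one, one_pow, sub_self, mul_eq_zero] at h2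
    simp_rw [← pow_mul, mul_comm _ (N - a + i), pow_mul]
    rw [h2.resolve_left (sub_ne_zero.mpr h1.symm), zero_smul]

theorem mem_of_isPrimitiveRoot_smul_mem {M : Type*} [AddCommGroup M] [Module ℂ M] {N : ℕ} {ω : ℂ}
    (hω : IsPrimitiveRoot ω N) (U : Submodule ℂ M) (v : ℕ → M)
    (h : ∀ j, ∑ i ∈ Finset.range N, (ω ^ j) ^ i • v i ∈ U) {a : ℕ} (ha : a < N) : v a ∈ U := by
  have hN : (N : ℂ) ≠ 0 := Nat.cast_ne_zero.mpr (by omega)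
  rw [← U.smul_mem_iff hN, ← sum_isPrimitiveRoot_smul hω v ha]
  exact U.sum_mem fun j _ => U.smul_mem _ (h j)

theorem Polynomial.sum_eval_isPrimitiveRoot {N : ℕ} {ω : ℂ} (hω : IsPrimitiveRoot ω N)
    (q : Polynomial ℂ) (hq : q.natDegree < N) :
    ∑ j ∈ Finset.range N, q.eval (ω ^ j) = N * q.eval 0 := by
  have h := sum_isPrimitiveRoot_smul hω q.coeff (a := 0) (by omega)
  rw [← Polynomial.coeff_zero_eq_eval_zero, ← smul_eq_mul, ← h]
  refine Finset.sum_congr rfl fun j _ => ?_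
  rw [Polynomial.eval_eq_sum_range' hq, Nat.sub_zero, ← pow_mul, mul_comm, pow_mul,
    hω.pow_eq_one, one_pow, one_smul]
  simp [mul_comm]

/-! ### Polynomial functions of a matrix -/

/-- The algebra of polynomial functions of the entries of a `2 × 2` matrix. -/
def matrixPolyFun : Subalgebra ℂ (Matrix (Fin 2) (Fin 2) ℂ → ℂ) :=
  Algebra.adjoin ℂ (Set.range fun ij : Fin 2 × Fin 2 => fun A => A ij.1 ij.2)

theorem entry_mem_matrixPolyFun (i j : Fin 2) : (fun A => A i j) ∈ matrixPolyFun :=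
  Algebra.subset_adjoin ⟨(i, j), rfl⟩

theorem det_mem_matrixPolyFun : Matrix.det ∈ matrixPolyFun := by
  have h : (Matrix.det : Matrix (Fin 2) (Fin 2) ℂ → ℂ) =
      (fun A => A 0 0) * (fun A => A 1 1) - (fun A => A 0 1) * (fun A => A 1 0) := by
    funext A
    simp [Matrix.det_fin_two]
  rw [h]
  exact sub_mem (mul_mem (entry_mem_matrixPolyFun _ _) (entry_mem_matrixPolyFun _ _))
    (mul_mem (entry_mem_matrixPolyFun _ _) (entry_mem_matrixPolyFun _ _))

theorem continuous_of_mem_matrixPolyFun {f : Matrix (Fin 2) (Fin 2) ℂ → ℂ}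
    (hf : f ∈ matrixPolyFun) : Continuous f := by
  induction hf using Algebra.adjoin_induction with
  | mem f hf =>
    obtain ⟨ij, rfl⟩ := hf
    exact continuous_id.matrix_elem _ _
  | algebraMap c => exact continuous_const
  | add f g _ _ hf hg => exact hf.add hg
  | mul f g _ _ hf hg => exact hf.mul hg

/-- The degree bound is uniform over all lines `t ↦ A + t B`: this is what allows one root of
unity to filter all of them at once. -/
theorem exists_polynomial_on_lines {f : Matrix (Fin 2) (Fin 2) ℂ → ℂ}
    (hf : f ∈ matrixPolyFun) : ∃ D : ℕ, ∀ A B, ∃ q : Polynomial ℂ, q.natDegree ≤ D ∧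
      ∀ t : ℂ, f (A + t • B) = q.eval t := by
  induction hf using Algebra.adjoin_induction with
  | mem f hf =>
    obtain ⟨ij, rfl⟩ := hf
    refine ⟨1, fun A B => ⟨Polynomial.C (B ij.1 ij.2) * Polynomial.X +
      Polynomial.C (A ij.1 ij.2), Polynomial.natDegree_linear_le, fun t => ?_⟩⟩
    simp
    ring
  | algebraMap c => exact ⟨0, fun A B => ⟨Polynomial.C c, by simp, fun t => by simp⟩⟩
  | add f g _ _ hf hg =>
    obtain ⟨D, hD⟩ := hf
    obtain ⟨E, hE⟩ := hg
    refine ⟨max D E, fun A B => ?_⟩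
    obtain ⟨p, hp, hp'⟩ := hD A B
    obtain ⟨q, hq, hq'⟩ := hE A B
    exact ⟨p + q, (Polynomial.natDegree_add_le _ _).trans (max_le_max hp hq), fun t => by
      simp [hp', hq']⟩
  | mul f g _ _ hf hg =>
    obtain ⟨D, hD⟩ := hf
    obtain ⟨E, hE⟩ := hg
    refine ⟨D + E, fun A B => ?_⟩
    obtain ⟨p, hp, hp'⟩ := hD A B
    obtain ⟨q, hq, hq'⟩ := hE A B
    exact ⟨p * q, Polynomial.natDegree_mul_le.trans (add_le_add hp hq), fun t => by
      simp [hp', hq']⟩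

/-- For a fixed form `p`, all coordinates of `symAlgMap A p` are polynomial in the entries of `A`. The
functional has to vary in the induction on `p`. -/
theorem symAlgMap_coeff_mem_matrixPolyFun (p : MvPolynomial (Fin 2) ℂ) :
    ∀ ψ : Module.Dual ℂ (MvPolynomial (Fin 2) ℂ),
      (fun A => ψ (symAlgMap A p)) ∈ matrixPolyFun := by
  induction p using MvPolynomial.induction_on with
  | C c =>
    intro ψ
    simp_rw [← MvPolynomial.algebraMap_eq, AlgHom.commutes]
    exact matrixPolyFun.algebraMap_mem (ψ (algebraMap ℂ _ c))
  | add p q hp hq =>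
    intro ψ
    simp_rw [map_add]
    exact add_mem (hp ψ) (hq ψ)
  | mul_X p j hp =>
    intro ψ
    have h : (fun A => ψ (symAlgMap A (p * MvPolynomial.X j))) = ∑ i, (fun A => A i j) *
        fun A => (ψ ∘ₗ LinearMap.mulRight ℂ (MvPolynomial.X i)) (symAlgMap A p) := by
      funext A
      simp [symAlgMap_X, mul_add]
    rw [h]
    exact sum_mem fun i _ => mul_mem (entry_mem_matrixPolyFun _ _) (hp _)

theorem piRep_coeff_mem_matrixPolyFun (n ℓ : ℕ) (L : Module.Dual ℂ (Module.End ℂ (SymC2 ℓ))) :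
    (fun A => L (piRep n ℓ A)) ∈ matrixPolyFun := by
  have hcoord : ∀ (φ : Module.Dual ℂ (SymC2 ℓ)) (p : SymC2 ℓ),
      (fun A => φ (piRep n ℓ A p)) ∈ matrixPolyFun := by
    intro φ p
    obtain ⟨ψ, rfl⟩ := LinearMap.exists_extend φ
    have h : (fun A => (ψ ∘ₗ Submodule.subtype _) (piRep n ℓ A p)) =
        Matrix.det ^ n * fun A => ψ (symAlgMap A p) := by
      funext A
      simp [piRep, symPow, LinearMap.restrict_apply]
    rw [h]
    exact mul_mem (pow_mem det_mem_matrixPolyFun n) (symAlgMap_coeff_mem_matrixPolyFun _ ψ)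
  have h : (fun A => L (piRep n ℓ A)) = ∑ i, ∑ j,
      L (((Module.finBasis ℂ (SymC2 ℓ)).coord j).smulRight (Module.finBasis ℂ (SymC2 ℓ) i)) •
        fun A => (Module.finBasis ℂ (SymC2 ℓ)).coord i
          (piRep n ℓ A (Module.finBasis ℂ (SymC2 ℓ) j)) := by
    funext A
    rw [dual_end_eq_sum (Module.finBasis ℂ (SymC2 ℓ)) L]
    simp only [Finset.sum_apply, Pi.smul_apply, smul_eq_mul]
  rw [h]
  exact sum_mem fun i _ => sum_mem fun j _ => matrixPolyFun.smul_mem (hcoord _ _) _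

theorem symPow_smul (ℓ : ℕ) (ζ : ℂ) (A : Matrix (Fin 2) (Fin 2) ℂ) :
    symPow ℓ (ζ • A) = ζ ^ ℓ • symPow ℓ A := by
  ext1 p
  apply Subtype.ext
  have h : ∀ d : Fin 2 →₀ ℕ, symAlgMap (ζ • A) (MvPolynomial.monomial d 1) =
      ζ ^ d.degree • symAlgMap A (MvPolynomial.monomial d 1) := by
    intro d
    simp only [MvPolynomial.monomial_eq, map_mul, map_one, Finsupp.prod_fintype,
      pow_zero, implies_true, map_pow, symAlgMap_X, Finsupp.degree_eq_sum, Fin.prod_univ_two,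
      Matrix.smul_apply, smul_assoc, ← Finset.smul_sum, smul_pow, Fin.sum_univ_two, pow_add,
      one_mul, smul_mul_smul_comm]
  have hp : ∀ d ∈ p.1.support, d.degree = ℓ := fun d hd =>
    (Finsupp.degree_eq_weight_one (R := ℕ) ▸ rfl : d.degree = _).trans <|
      (MvPolynomial.mem_homogeneousSubmodule ℓ p.1).mp p.2 (MvPolynomial.mem_support_iff.mp hd)
  change symAlgMap (ζ • A) p.1 = ζ ^ ℓ • symAlgMap A p.1
  conv_lhs => rw [p.1.as_sum]
  conv_rhs => rw [p.1.as_sum]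
  rw [map_sum, map_sum, Finset.smul_sum]
  refine Finset.sum_congr rfl fun d hd => ?_
  rw [← mul_one (MvPolynomial.coeff d p.1), ← smul_eq_mul, ← MvPolynomial.smul_monomial, map_smul,
    map_smul, h, hp d hd, smul_comm]

theorem piRep_smul (n ℓ : ℕ) (ζ : ℂ) (A : Matrix (Fin 2) (Fin 2) ℂ) :
    piRep n ℓ (ζ • A) = ζ ^ (2 * n + ℓ) • piRep n ℓ A := by
  change (ζ • A).det ^ (n : ℤ) • symPow ℓ (ζ • A) = _ • A.det ^ (n : ℤ) • symPow ℓ A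
  rw [symPow_smul, Matrix.det_smul, Fintype.card_fin, zpow_natCast, zpow_natCast, mul_pow,
    ← pow_mul, pow_add, smul_smul, smul_smul]
  congr 1
  ring

/-! ### Irreducibility of the symmetric powers -/

theorem exists_eq_sum_of_isHomogeneous {ℓ : ℕ} {p : MvPolynomial (Fin 2) ℂ}
    (hp : p.IsHomogeneous ℓ) : ∃ c : ℕ → ℂ, p = ∑ a ∈ Finset.range (ℓ + 1),
      c a • (MvPolynomial.X 0 ^ a * MvPolynomial.X 1 ^ (ℓ - a)) := by
  refine ⟨fun a => p.coeff (Finsupp.single 0 a + Finsupp.single 1 (ℓ - a)), ?_⟩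
  have hm : ∀ a, (MvPolynomial.X 0 ^ a * MvPolynomial.X 1 ^ (ℓ - a) : MvPolynomial (Fin 2) ℂ) =
      MvPolynomial.monomial (Finsupp.single 0 a + Finsupp.single 1 (ℓ - a)) 1 := by
    intro a
    rw [MvPolynomial.X_pow_eq_monomial, MvPolynomial.X_pow_eq_monomial,
      MvPolynomial.monomial_mul, one_mul]
  ext d
  simp only [hm, MvPolynomial.coeff_sum, MvPolynomial.coeff_smul, MvPolynomial.coeff_monomial]
  by_cases hd : d.degree = ℓ
  · have hd2 : d 0 + d 1 = ℓ := by
      rw [← hd, Finsupp.degree_eq_sum, Fin.sum_univ_two]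
    have he : Finsupp.single 0 (d 0) + Finsupp.single 1 (ℓ - d 0) = d := by
      ext i
      fin_cases i
      · simp
      · simp
        omega
    rw [Finset.sum_eq_single_of_mem (d 0) (Finset.mem_range.mpr (by omega))]
    · rw [he]
      simp
    · intro a _ ha
      rw [if_neg, smul_zero]
      rintro rfl
      simp at ha
  · rw [hp.coeff_eq_zero hd, Finset.sum_eq_zero]
    intro a ha
    rw [if_neg, smul_zero]
    rintro rfl
    rw [Finset.mem_range] at ha
    refine hd ?_
    rw [Finsupp.degree_eq_sum, Fin.sum_univ_two]
    simp
    omega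

/-- The rotation with rational entries `3/5`, `4/5`; all that matters is that no entry is `0`. -/
noncomputable def rotationMatrix : Matrix (Fin 2) (Fin 2) ℂ := !![3 / 5, -(4 / 5); 4 / 5, 3 / 5]

theorem rotationMatrix_mem : rotationMatrix ∈ Matrix.unitaryGroup (Fin 2) ℂ := by
  rw [Matrix.mem_unitaryGroup_iff]
  ext i j
  fin_cases i <;> fin_cases j <;>
    simp [rotationMatrix, Matrix.mul_apply, Fin.sum_univ_two, Matrix.star_apply,
        Complex.conj_ofNat] <;> norm_num

theorem diagonal_mem_unitaryGroup {ζ : ℂ} (hζ : ‖ζ‖ = 1) :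
    (!![ζ, 0; 0, 1] : Matrix (Fin 2) (Fin 2) ℂ) ∈ Matrix.unitaryGroup (Fin 2) ℂ := by
  have h : ζ * star ζ = 1 := by
    rw [Complex.star_def, Complex.mul_conj, Complex.normSq_eq_norm_sq, hζ]
    norm_num
  rw [Matrix.mem_unitaryGroup_iff]
  ext i j
  fin_cases i <;> fin_cases j <;>
    simp [Matrix.mul_apply, Fin.sum_univ_two, Matrix.star_apply]
  simpa using h

theorem symAlgMap_monomial (A : Matrix (Fin 2) (Fin 2) ℂ) (a b : ℕ) :
    symAlgMap A (MvPolynomial.X 0 ^ a * MvPolynomial.X 1 ^ b) =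
      (A 0 0 • MvPolynomial.X 0 + A 1 0 • MvPolynomial.X 1) ^ a *
        (A 0 1 • MvPolynomial.X 0 + A 1 1 • MvPolynomial.X 1) ^ b := by
  simp [symAlgMap_X]

/-- A nonzero subspace of the forms of degree `ℓ` that is invariant under `U(2)` contains all
monomials: the torus isolates one monomial, a rotation turns it into a form with a nonzero
`X₀ ^ ℓ` coefficient, and a rotation of `X₀ ^ ℓ` has only nonzero coefficients. -/
theorem monomial_mem_of_invariant {ℓ : ℕ} {U : Submodule ℂ (MvPolynomial (Fin 2) ℂ)}
    (hU : ∀ A ∈ Matrix.unitaryGroup (Fin 2) ℂ, ∀ p ∈ U, symAlgMap A p ∈ U)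
    {p : MvPolynomial (Fin 2) ℂ} (hp : p.IsHomogeneous ℓ) (hpU : p ∈ U) (hp0 : p ≠ 0)
    {a : ℕ} (ha : a ≤ ℓ) : MvPolynomial.X 0 ^ a * MvPolynomial.X 1 ^ (ℓ - a) ∈ U := by
  have hω := Complex.isPrimitiveRoot_exp (ℓ + 1) (Nat.succ_ne_zero ℓ)
  set ω := Complex.exp (2 * Real.pi * Complex.I / (ℓ + 1 : ℕ))
  have key : ∀ c : ℕ → ℂ, ∑ i ∈ Finset.range (ℓ + 1),
      c i • (MvPolynomial.X 0 ^ i * MvPolynomial.X 1 ^ (ℓ - i)) ∈ U →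
      ∀ i ≤ ℓ, c i ≠ 0 → MvPolynomial.X 0 ^ i * MvPolynomial.X 1 ^ (ℓ - i) ∈ U := by
    intro c hc i hi hci
    rw [← U.smul_mem_iff hci]
    refine mem_of_isPrimitiveRoot_smul_mem hω U
      (fun i => c i • (MvPolynomial.X 0 ^ i * MvPolynomial.X 1 ^ (ℓ - i))) (fun j => ?_)
      (Nat.lt_succ_of_le hi)
    have hn : ‖ω ^ j‖ = 1 := by
      rw [norm_pow, hω.norm'_eq_one (Nat.succ_ne_zero ℓ), one_pow]
    convert hU _ (diagonal_mem_unitaryGroup hn) _ hc using 1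
    rw [map_sum]
    refine Finset.sum_congr rfl fun i _ => ?_
    rw [map_smul, symAlgMap_monomial, smul_comm]
    simp [smul_pow]
  have htop : MvPolynomial.X 0 ^ ℓ * MvPolynomial.X 1 ^ (ℓ - ℓ) ∈ U := by
    obtain ⟨c, hc⟩ := exists_eq_sum_of_isHomogeneous hp
    obtain ⟨i, hi, hci⟩ : ∃ i ≤ ℓ, c i ≠ 0 := by
      by_contra! h
      refine hp0 (hc.trans (Finset.sum_eq_zero fun i hi => ?_))
      rw [h i (Nat.lt_succ_iff.mp (Finset.mem_range.mp hi)), zero_smul]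
    have hmon := hU _ rotationMatrix_mem _ (key c (hc ▸ hpU) i hi hci)
    have hh : (symAlgMap rotationMatrix (MvPolynomial.X 0 ^ i *
        MvPolynomial.X 1 ^ (ℓ - i))).IsHomogeneous ℓ := by
      refine symAlgMap_mem rotationMatrix ℓ _ ?_
      have h1 := (MvPolynomial.isHomogeneous_X_pow (R := ℂ) (0 : Fin 2) i).mul
        (MvPolynomial.isHomogeneous_X_pow (R := ℂ) (1 : Fin 2) (ℓ - i))
      rwa [Nat.add_sub_cancel' hi] at h1
    obtain ⟨e, he⟩ := exists_eq_sum_of_isHomogeneous hh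
    refine key e (he ▸ hmon) ℓ le_rfl ?_
    -- The coefficient of `X₀ ^ ℓ` is the value at `(1, 0)`.
    have hev := congrArg (MvPolynomial.eval ![1, 0]) he
    rw [symAlgMap_monomial, map_sum, Finset.sum_eq_single_of_mem ℓ (Finset.self_mem_range_succ ℓ)]
      at hev
    · intro h0
      simp [rotationMatrix, h0, MvPolynomial.smul_eval] at hev
    · intro b hb hbℓ
      have : ℓ - b ≠ 0 := by
        have := Finset.mem_range.mp hb
        omega
      simp [MvPolynomial.smul_eval, this]
  have hrot := hU _ rotationMatrix_mem _ htop
  rw [symAlgMap_monomial, Nat.sub_self, pow_zero, mul_one, add_pow] at hrot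
  refine key (fun i => (3 / 5) ^ i * (4 / 5) ^ (ℓ - i) * (ℓ.choose i : ℂ)) ?_ a ha ?_
  · convert hrot using 1
    refine Finset.sum_congr rfl fun i _ => ?_
    simp only [rotationMatrix, smul_pow, smul_mul_smul_comm, Matrix.of_apply, Matrix.cons_val_zero,
      Matrix.cons_val_one]
    simp [MvPolynomial.smul_eq_C_mul]
    ring
  · have := (Nat.choose_pos ha).ne'
    simp [this]

theorem det_ne_zero_of_mem_unitaryGroup {A : Matrix (Fin 2) (Fin 2) ℂ}
    (hA : A ∈ Matrix.unitaryGroup (Fin 2) ℂ) : A.det ≠ 0 := by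
  intro h0
  have h1 := congrArg Matrix.det (Matrix.mem_unitaryGroup_iff.mp hA)
  simp [h0] at h1

/-- Irreducibility only depends on the values in `U(2)`, where the factor `det ^ n` is invertible. -/
theorem isIrreducibleFamily_of_unitaryGroup {X : Type*} (n ℓ : ℕ)
    (f : X → Matrix (Fin 2) (Fin 2) ℂ) (hf : ∀ A ∈ Matrix.unitaryGroup (Fin 2) ℂ, ∃ x, f x = A) :
    IsIrreducibleFamily fun x => piRep n ℓ (f x) := by
  refine ⟨⟨⟨MvPolynomial.X 0 ^ ℓ, MvPolynomial.isHomogeneous_X_pow _ _⟩, 0, fun h => ?_⟩,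
    fun U hU => ?_⟩
  · exact pow_ne_zero ℓ (MvPolynomial.X_ne_zero (R := ℂ) (0 : Fin 2)) (congrArg Subtype.val h)
  rw [or_iff_not_imp_left]
  intro hbot
  obtain ⟨p, hpU, hp0⟩ := U.ne_bot_iff.mp hbot
  have hinv : ∀ A ∈ Matrix.unitaryGroup (Fin 2) ℂ, ∀ q ∈ U.map (Submodule.subtype _),
      symAlgMap A q ∈ U.map (Submodule.subtype _) := by
    rintro A hA _ ⟨q, hq, rfl⟩
    obtain ⟨x, rfl⟩ := hf A hA
    refine ⟨symPow ℓ (f x) q, ?_, rfl⟩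
    rw [SetLike.mem_coe,
      ← U.smul_mem_iff (zpow_ne_zero (n : ℤ) (det_ne_zero_of_mem_unitaryGroup hA))]
    exact hU x q hq
  refine Submodule.eq_top_iff'.mpr fun q => ?_
  have hq : q.1 ∈ U.map (Submodule.subtype _) := by
    obtain ⟨c, hc⟩ := exists_eq_sum_of_isHomogeneous q.2
    rw [hc]
    exact Submodule.sum_mem _ fun a ha => Submodule.smul_mem _ _
      (monomial_mem_of_invariant hinv p.2 ⟨p, hpU, rfl⟩ (fun h => hp0 (Subtype.ext h))
        (Nat.lt_succ_iff.mp (Finset.mem_range.mp ha)))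
  obtain ⟨r, hr, hrq⟩ := hq
  rwa [← Subtype.ext hrq]

/-! ### The block structure of `SU(3)` -/

theorem blockDiag_mem {A : Matrix (Fin 2) (Fin 2) ℂ} (hA : A ∈ Matrix.unitaryGroup (Fin 2) ℂ) :
    blockDiag A ∈ Matrix.specialUnitaryGroup (Fin 3) ℂ := by
  rw [Matrix.mem_specialUnitaryGroup_iff, Matrix.mem_unitaryGroup_iff]
  constructor
  · rw [← blockDiag_star, ← blockDiag_mul, Matrix.mem_unitaryGroup_iff.mp hA]
    ext i j
    fin_cases i <;> fin_cases j <;> simp [blockDiag]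
  · have h : (blockDiag A).det = A.det * A.det⁻¹ := by
      rw [Matrix.det_fin_three, Matrix.det_fin_two]
      simp [blockDiag, Matrix.det_fin_two]
      ring
    rw [h, mul_inv_cancel₀ (det_ne_zero_of_mem_unitaryGroup hA)]

/-- The element of `K` with upper left block `A`. -/
noncomputable def ofBlock (A : Matrix (Fin 2) (Fin 2) ℂ)
    (hA : A ∈ Matrix.unitaryGroup (Fin 2) ℂ) : subgroupK :=
  ⟨⟨blockDiag A, blockDiag_mem hA⟩, A, hA, rfl⟩

theorem blockHom_ofBlock (A : Matrix (Fin 2) (Fin 2) ℂ)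
    (hA : A ∈ Matrix.unitaryGroup (Fin 2) ℂ) : blockHom (ofBlock A hA) = A :=
  upperLeft_blockDiag A

theorem piK_apply (n : ℤ) (ℓ : ℕ) (k : subgroupK) : piK n ℓ k = piRep n ℓ (blockHom k) := rfl

theorem smul_one_mem_unitaryGroup {ζ : ℂ} (hζ : ‖ζ‖ = 1) :
    (ζ • 1 : Matrix (Fin 2) (Fin 2) ℂ) ∈ Matrix.unitaryGroup (Fin 2) ℂ := by
  have h : star ζ * ζ = 1 := by
    rw [Complex.star_def, mul_comm, Complex.mul_conj, Complex.normSq_eq_norm_sq, hζ]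
    norm_num
  rw [Matrix.mem_unitaryGroup_iff, star_smul, star_one, smul_mul_smul_comm, mul_comm, h, one_smul,
    one_mul]

/-- The contribution to the upper left block of `x * k * y`, for `k ∈ K` with block `U`, of the
off-diagonal blocks of `x` and `y`. -/
noncomputable def offBlock (x y : SU3) (U : Matrix (Fin 2) (Fin 2) ℂ) :
    Matrix (Fin 2) (Fin 2) ℂ :=
  U.det⁻¹ • !![x.1 0 2 * y.1 2 0, x.1 0 2 * y.1 2 1; x.1 1 2 * y.1 2 0, x.1 1 2 * y.1 2 1]

theorem upperLeft_mul_mul (x y : SU3) (k : subgroupK) :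
    upperLeft (x * k * y : SU3) =
      upperLeft x * blockHom k * upperLeft y + offBlock x y (blockHom k) := by
  obtain ⟨k, A, hA, hk⟩ := k
  have hb : blockHom ⟨k, A, hA, hk⟩ = A := by
    change upperLeft k.1 = A
    rw [hk, upperLeft_blockDiag]
  rw [hb]
  change upperLeft (x.1 * k.1 * y.1) = _
  rw [hk]
  ext i j
  fin_cases i <;> fin_cases j <;>
    simp [upperLeft, blockDiag, offBlock, Matrix.mul_apply, Fin.sum_univ_succ,
        Matrix.vecMul, dotProduct] <;> ring

theorem offBlock_smul (x y : SU3) (ζ : ℂ) (U : Matrix (Fin 2) (Fin 2) ℂ) :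
    offBlock x y (ζ • U) = (ζ ^ 2)⁻¹ • offBlock x y U := by
  rw [offBlock, offBlock, Matrix.det_smul, Fintype.card_fin, mul_inv, smul_smul]

/-! ### The spherical function -/

theorem continuousEnd_piRep (n ℓ : ℕ) : ContinuousEnd fun A => piRep n ℓ A :=
  fun L => continuous_of_mem_matrixPolyFun (piRep_coeff_mem_matrixPolyFun n ℓ L)

theorem continuousEnd_PhiPi (n ℓ : ℕ) : ContinuousEnd (PhiPi n ℓ) :=
  (continuousEnd_piRep n ℓ).comp (continuous_upperLeft.comp continuous_subtype_val)

theorem continuous_blockHom : Continuous blockHom :=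
  continuous_upperLeft.comp (continuous_subtype_val.comp continuous_subtype_val)

theorem continuousEnd_piK (n ℓ : ℕ) : ContinuousEnd fun k => piK n ℓ k :=
  (continuousEnd_piRep n ℓ).comp continuous_blockHom

theorem isIrreducible_piK (n ℓ : ℕ) : (piK n ℓ).IsIrreducible :=
  Representation.isIrreducible_of_isIrreducibleFamily <|
    isIrreducibleFamily_of_unitaryGroup n ℓ blockHom fun A hA => ⟨_, blockHom_ofBlock A hA⟩

theorem continuous_degChar {K : Type*} [Group K] [TopologicalSpace K] [IsTopologicalGroup K]
    {V : Type*} [AddCommGroup V] [Module ℂ V] {δ : Representation ℂ K V}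
    (hc : ContinuousEnd fun k => δ k) : Continuous fun k => degChar δ k⁻¹ :=
  continuous_const.mul ((hc (LinearMap.trace ℂ V)).comp continuous_inv)

/-- The centre of `K` acts in `π` by the character `ζ ↦ ζ ^ (2 n + ℓ)`, seen on `χ_π`. -/
theorem degChar_ofBlock_mul_inv (n ℓ : ℕ) {ζ : ℂ} (hζ : ‖ζ‖ = 1) (k : subgroupK) :
    ζ ^ (2 * n + ℓ) *
      degChar (piK n ℓ) (ofBlock (ζ • 1) (smul_one_mem_unitaryGroup hζ) * k)⁻¹ =
        degChar (piK n ℓ) k⁻¹ := by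
  set z := ofBlock (ζ • 1) (smul_one_mem_unitaryGroup hζ) with hz
  have h : piK n ℓ k⁻¹ = ζ ^ (2 * n + ℓ) • piK n ℓ (z * k)⁻¹ := by
    have h1 : piK n ℓ z = ζ ^ (2 * n + ℓ) • 1 := by
      rw [piK_apply, hz, blockHom_ofBlock, piRep_smul, map_one]
    calc piK n ℓ k⁻¹ = piK n ℓ (z * k)⁻¹ * piK n ℓ z := by
          rw [← map_mul]
          simp
      _ = _ := by rw [h1, mul_smul_comm, mul_one]
  rw [degChar, degChar, h, map_smul, smul_eq_mul]
  ring

/-- Translation by the centre of `K` rotates the off-diagonal contribution relative to the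
diagonal one, so that the integral does not depend on the parameter `w` of modulus one. -/
theorem integral_eq_integral_rotate (n ℓ : ℕ) (x y : SU3)
    (L : Module.Dual ℂ (Module.End ℂ (SymC2 ℓ))) {w : ℂ} (hw : ‖w‖ = 1) :
    ∫ k, degChar (piK n ℓ) k⁻¹ * L (PhiPi n ℓ (x * k * y)) ∂(normalizedHaar subgroupK) =
      ∫ k, degChar (piK n ℓ) k⁻¹ * L (piRep n ℓ (upperLeft x * blockHom k * upperLeft y +
        w • offBlock x y (blockHom k))) ∂(normalizedHaar subgroupK) := by
  -- Multiplying `U` by `ζ` turns `x U y + offBlock` into `ζ • (x U y + ζ⁻³ • offBlock)`.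
  obtain ⟨ζ, hζ3⟩ := IsAlgClosed.exists_pow_nat_eq w⁻¹ (n := 3) (by norm_num)
  have hζ : ‖ζ‖ = 1 := by
    rw [← pow_eq_one_iff_of_nonneg (norm_nonneg ζ) (n := 3) (by norm_num), ← norm_pow, hζ3,
      norm_inv, hw, inv_one]
  have hζ0 : ζ ≠ 0 := fun h => by simp [h] at hζ
  have hw3 : w = (ζ ^ 3)⁻¹ := by rw [hζ3, inv_inv]
  rw [← integral_mul_left_eq_self _ (ofBlock (ζ • 1) (smul_one_mem_unitaryGroup hζ))]
  refine integral_congr_ae (Filter.Eventually.of_forall fun k => ?_)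
  beta_reduce
  rw [PhiPi, upperLeft_mul_mul, map_mul, blockHom_ofBlock, smul_mul_assoc, one_mul, offBlock_smul,
    mul_smul_comm, smul_mul_assoc, ← degChar_ofBlock_mul_inv n ℓ hζ k]
  have h : ζ • (upperLeft x * blockHom k * upperLeft y) + (ζ ^ 2)⁻¹ • offBlock x y (blockHom k) =
      ζ • (upperLeft x * blockHom k * upperLeft y + w • offBlock x y (blockHom k)) := by
    rw [smul_add, smul_smul, hw3]
    congr 2
    field_simp
  rw [h, piRep_smul, map_smul, smul_eq_mul]
  ring

/-- Averaging over the rotations by roots of unity of large order removes the off-diagonal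
contribution: what remains is the constant term of a polynomial in the rotation parameter. -/
theorem integral_PhiPi_eq (n ℓ : ℕ) (x y : SU3) (L : Module.Dual ℂ (Module.End ℂ (SymC2 ℓ))) :
    ∫ k, degChar (piK n ℓ) k⁻¹ * L (PhiPi n ℓ (x * k * y)) ∂(normalizedHaar subgroupK) =
      ∫ k, degChar (piK n ℓ) k⁻¹ * L (piRep n ℓ (upperLeft x * blockHom k * upperLeft y))
        ∂(normalizedHaar subgroupK) := by
  obtain ⟨D, hD⟩ := exists_polynomial_on_lines (piRep_coeff_mem_matrixPolyFun n ℓ L)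
  have hω := Complex.isPrimitiveRoot_exp (D + 1) (Nat.succ_ne_zero D)
  set ω := Complex.exp (2 * Real.pi * Complex.I / (D + 1 : ℕ))
  have hN : ((D + 1 : ℕ) : ℂ) ≠ 0 := Nat.cast_ne_zero.mpr (Nat.succ_ne_zero D)
  have hpt : ∀ k, ∑ j ∈ Finset.range (D + 1), degChar (piK n ℓ) k⁻¹ *
      L (piRep n ℓ (upperLeft x * blockHom k * upperLeft y +
        (ω ^ j) • offBlock x y (blockHom k))) =
      (D + 1 : ℕ) * (degChar (piK n ℓ) k⁻¹ *
        L (piRep n ℓ (upperLeft x * blockHom k * upperLeft y))) := by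
    intro k
    obtain ⟨q, hq, hqt⟩ := hD (upperLeft x * blockHom k * upperLeft y)
      (offBlock x y (blockHom k))
    have h0 := hqt 0
    rw [zero_smul, add_zero] at h0
    rw [← Finset.mul_sum, h0]
    simp_rw [hqt]
    rw [Polynomial.sum_eval_isPrimitiveRoot hω q (Nat.lt_succ_of_le hq)]
    ring
  have hoff : Continuous fun k : subgroupK => offBlock x y (blockHom k) :=
    (continuous_blockHom.matrix_det.inv₀ fun k => by
      obtain ⟨A, hA, hk⟩ := k.2
      have hb : blockHom k = A := (congrArg upperLeft hk).trans (upperLeft_blockDiag A)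
      rw [hb]
      exact det_ne_zero_of_mem_unitaryGroup hA).smul continuous_const
  have hint : ∀ w : ℂ, Integrable (fun k => degChar (piK n ℓ) k⁻¹ *
      L (piRep n ℓ (upperLeft x * blockHom k * upperLeft y + w • offBlock x y (blockHom k))))
      (normalizedHaar subgroupK) := by
    intro w
    refine Continuous.integrable_of_hasCompactSupport ?_ (HasCompactSupport.of_compactSpace _)
    exact (continuous_degChar (continuousEnd_piK n ℓ)).mul
      ((continuousEnd_piRep n ℓ L).comp
        (((continuous_const.mul continuous_blockHom).mul continuous_const).add
          (hoff.const_smul w)))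
  have hsum := integral_finsetSum (μ := normalizedHaar subgroupK) (Finset.range (D + 1))
    fun j _ => hint (ω ^ j)
  simp_rw [hpt] at hsum
  have hrot : ∀ j, ‖ω ^ j‖ = 1 := fun j => by
    rw [norm_pow, hω.norm'_eq_one (Nat.succ_ne_zero D), one_pow]
  rw [integral_const_mul, Finset.sum_congr rfl fun j _ =>
    (integral_eq_integral_rotate n ℓ x y L (hrot j)).symm, Finset.sum_const, Finset.card_range,
    nsmul_eq_mul] at hsum
  exact (mul_left_cancel₀ hN hsum).symm

theorem hasEndIntegral_PhiPi (n ℓ : ℕ) (x y : SU3) :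
    HasEndIntegral (normalizedHaar subgroupK)
      (fun k : subgroupK => degChar (piK n ℓ) k⁻¹ • PhiPi n ℓ (x * k * y))
      (PhiPi n ℓ x * PhiPi n ℓ y) := by
  intro L
  have hschur := (hasEndIntegral_degChar_smul (isIrreducible_piK n ℓ)
    (continuousEnd_piK n ℓ)).map (LinearMap.mulLeft ℂ (PhiPi n ℓ x) ∘ₗ
      LinearMap.mulRight ℂ (PhiPi n ℓ y)) L
  simp_rw [map_smul, smul_eq_mul] at hschur ⊢
  refine ⟨?_, ?_⟩
  · refine Continuous.integrable_of_hasCompactSupport ?_ (HasCompactSupport.of_compactSpace _)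
    exact (continuous_degChar (continuousEnd_piK n ℓ)).mul ((continuousEnd_PhiPi n ℓ L).comp
      ((continuous_const.mul continuous_subtype_val).mul continuous_const))
  · rw [integral_PhiPi_eq]
    convert hschur.2 using 5 with k
    · simp [piK_apply, PhiPi, mul_assoc]
    · simp

theorem theorem2p6 (n : ℤ) (hn : 0 ≤ n) (ℓ : ℕ) :
    IsSphericalFunction subgroupK (piK n ℓ) (PhiPi n ℓ) ∧ IsIrreducibleFamily (PhiPi n ℓ) := by
  lift n to ℕ using hn
  refine ⟨⟨isIrreducible_piK n ℓ, continuousEnd_piK n ℓ, continuousEnd_PhiPi n ℓ, ?_,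
    hasEndIntegral_PhiPi n ℓ⟩, isIrreducibleFamily_of_unitaryGroup n ℓ _ fun A hA =>
      ⟨ofBlock A hA, blockHom_ofBlock A hA⟩⟩
  exact map_one (piK n ℓ)
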